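/- Let $k\ge 0$, let $S$ be the set of $k$-matchings (sets of $k$ pairwise disjoint edges, i.e. perfect matchings) of the complete graph $K_{2k}$, and let the symmetric group $S_{2k}$ act on $\mathbb{C}[S]$ by permuting the vertices. For a partition $\lambda$ of $2k$ let $M^\lambda$ be the complex permutation module of $S_{2k}$ whose basis is the set of tabloids of shape $\lambda$. For a tableau $t$ of shape $\lambda$ with tabloid $\{t\}$ and column group $C_t$ let $e_t=\sum_{\pi\in C_t}\operatorname{sign}(\pi)\,\pi\{t\}$ be its polytabloid, and let the Specht module $S^\lambda\subseteq M^\lambda$ be the span of all $e_t$. Call $\lambda$ even if all its parts are even. For an even $\lambda$ let $f_\lambda\colon M^\lambda\to\mathbb{C}[S]$ be the linear map that sends a tabloid with rows $R_1,\dots,R_r$ to $\prod_{i=1}^r f(R_i)$, where $f(R_i)$ is the sum of all perfect matchings of the set $R_i$ and the product of disjoint matchings is their union. Then: (1) for each even partition $\lambda$ of $2k$, $f_\lambda$ is a homomorphism of $S_{2k}$-modules, $f_\lambda(e_t)\neq 0$ for the standard tableau $t$ of shape $\lambda$ whose entries $1,\dots,2k$ increase when the cells are read row by row, and the restriction of $f_\lambda$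 to $S^\lambda$ is injective; (2) the linear map $\bigoplus_{\lambda} S^\lambda\to\mathbb{C}[S]$, the sum being over all even partitions $\lambda$ of $2k$, that equals $f_\lambda$ on the summand $S^\lambda$ is an isomorphism of $S_{2k}$-modules; (3) for each even partition $\lambda$ of $2k$, the module $S^\lambda$ is irreducible and has multiplicity $1$ in $\mathbb{C}[S]$, i.e. $\dim_{\mathbb{C}}\operatorname{Hom}_{S_{2k}}(S^\lambda,\mathbb{C}[S])=1$. -/

import Mathlib

open scoped MonoidAlgebra DirectSum

namespace SpechtMatching

/-! ### Partitions and Young diagrams -/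

/-- The Young diagram of a partition: row `i` (counted from `0`) has length the `i`-th largest
part. -/
def diagram {n : ℕ} (p : n.Partition) : YoungDiagram :=
  YoungDiagram.ofRowLens (p.parts.sort (· ≥ ·)) (p.parts.pairwise_sort (· ≥ ·)).sortedGE

theorem card_cellsOfRowLens (w : List ℕ) : (YoungDiagram.cellsOfRowLens w).card = w.sum := by
  induction w with
  | nil => rfl
  | cons a w ih =>
    rw [YoungDiagram.cellsOfRowLens, Finset.card_union_of_disjoint]
    · simp [ih]
    · rw [Finset.disjoint_left]
      rintro ⟨i, j⟩ h1 h2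
      simp only [Finset.mem_product, Finset.mem_singleton] at h1
      simp only [Finset.mem_map, Prod.exists] at h2
      obtain ⟨a, b, -, h⟩ := h2
      have := congrArg Prod.fst h
      simp at this
      omega

theorem card_diagram {n : ℕ} (p : n.Partition) : (diagram p).cells.card = n := by
  change (YoungDiagram.cellsOfRowLens _).card = n
  rw [card_cellsOfRowLens, ← Multiset.sum_coe, Multiset.sort_eq, p.parts_sum]

/-- The partitions of `2k` all of whose parts are even. -/
abbrev EvenPartition (k : ℕ) : Type :=
  {p : (2 * k).Partition // ∀ i ∈ p.parts, Even i}

/-! ### Tableaux, tabloids, polytabloids, Specht modules -/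

/-- A (bijective) tableau of shape `μ` with entries `0, …, n - 1`: the cell `(i, j)` is in row `i`
and column `j`. -/
abbrev Tableau (μ : YoungDiagram) (n : ℕ) : Type :=
  {c : ℕ × ℕ // c ∈ μ.cells} ≃ Fin n

/-- The row of a tableau that contains the entry `x`. -/
def Tableau.rowOf {μ : YoungDiagram} {n : ℕ} (t : Tableau μ n) (x : Fin n) : ℕ :=
  (t.symm x).1.1

/-- The column of a tableau that contains the entry `x`. -/
def Tableau.colOf {μ : YoungDiagram} {n : ℕ} (t : Tableau μ n) (x : Fin n) : ℕ :=
  (t.symm x).1.2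

/-- The tableau `σ t`, obtained by applying `σ` to every entry of `t`. -/
def Tableau.perm {μ : YoungDiagram} {n : ℕ} (σ : Equiv.Perm (Fin n)) (t : Tableau μ n) :
    Tableau μ n :=
  Equiv.trans t σ

/-- The tableau of shape `μ` whose entries increase when the cells are read row by row, from the
top row to the bottom row and from left to right in each row. -/
def standardTableau {μ : YoungDiagram} {n : ℕ} (h : μ.cells.card = n) : Tableau μ n :=
  (toLex.subtypeEquiv (q := fun c => c ∈ μ.cells.map toLex.toEmbedding)
      fun _ => (Finset.mem_map' _).symm).trans
    (((μ.cells.map toLex.toEmbedding).orderIsoOfFin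
      ((Finset.card_map _).trans h)).symm.toEquiv)

/-- Tabloids of shape `μ`: tableaux of shape `μ` up to permutations of the entries in each row. Two
tableaux are row equivalent iff they assign the same row to every entry, so that the class
of `t` is recorded as the function `t.rowOf`. -/
@[ext]
structure Tabloid (μ : YoungDiagram) (n : ℕ) where
  /-- The row that contains a given entry. -/
  rowOf : Fin n → ℕ
  exists_tableau : ∃ t : Tableau μ n, t.rowOf = rowOf

/-- The tabloid `{t}` of a tableau `t`. -/
def Tableau.tabloid {μ : YoungDiagram} {n : ℕ} (t : Tableau μ n) : Tabloid μ n :=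
  ⟨t.rowOf, t, rfl⟩

/-- The symmetric group acts on tabloids by permuting the entries, `σ{t} = {σ t}`. -/
instance (μ : YoungDiagram) (n : ℕ) : MulAction (Equiv.Perm (Fin n)) (Tabloid μ n) where
  smul σ T := ⟨fun x => T.rowOf (σ⁻¹ x), by
    obtain ⟨t, ht⟩ := T.exists_tableau
    exact ⟨t.perm σ, by rw [← ht]; rfl⟩⟩
  one_smul _ := rfl
  mul_smul _ _ _ := rfl

theorem smul_tabloid {μ : YoungDiagram} {n : ℕ} (σ : Equiv.Perm (Fin n)) (t : Tableau μ n) :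
    σ • t.tabloid = (t.perm σ).tabloid := rfl

/-- The permutation module `M^μ` with basis the tabloids of shape `μ`. -/
noncomputable abbrev permModule (μ : YoungDiagram) (n : ℕ) :
    Representation ℂ (Equiv.Perm (Fin n)) ℂ[Tabloid μ n] :=
  Representation.ofMulAction ℂ (Equiv.Perm (Fin n)) (Tabloid μ n)

/-- The column group of a tableau: the permutations that map every entry to an entry of the same
column. -/
def columnGroup {μ : YoungDiagram} {n : ℕ} (t : Tableau μ n) : Finset (Equiv.Perm (Fin n)) :=
  Finset.univ.filter fun σ => ∀ x, t.colOf (σ x) = t.colOf x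

/-- The polytabloid `e_t`, the sum of `sign(σ) σ{t}` over the column group of `t`. -/
noncomputable def polytabloid {μ : YoungDiagram} {n : ℕ} (t : Tableau μ n) : ℂ[Tabloid μ n] :=
  ∑ σ ∈ columnGroup t, MonoidAlgebra.single (σ • t.tabloid) ((Equiv.Perm.sign σ : ℤ) : ℂ)

theorem permModule_polytabloid {μ : YoungDiagram} {n : ℕ} (g : Equiv.Perm (Fin n))
    (t : Tableau μ n) : permModule μ n g (polytabloid t) = polytabloid (t.perm g) := by
  unfold polytabloid
  rw [map_sum]
  refine Finset.sum_bij' (fun σ _ => g * σ * g⁻¹) (fun σ _ => g⁻¹ * σ * g) ?_ ?_ ?_ ?_ ?_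
  · intro σ hσ
    simp only [columnGroup, Finset.mem_filter, Finset.mem_univ, true_and] at hσ ⊢
    intro x
    have h := hσ (g⁻¹ x)
    have e : g⁻¹ (g (σ (g⁻¹ x))) = σ (g⁻¹ x) := Equiv.symm_apply_apply g _
    change t.colOf (g⁻¹ (g (σ (g⁻¹ x)))) = t.colOf (g⁻¹ x)
    rw [e, h]
  · intro σ hσ
    simp only [columnGroup, Finset.mem_filter, Finset.mem_univ, true_and] at hσ ⊢
    intro x
    have h := hσ (g x)
    change t.colOf (g⁻¹ (σ (g x))) = t.colOf (g⁻¹ (g x)) at h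
    have e : g⁻¹ (g x) = x := Equiv.symm_apply_apply g _
    rw [e] at h
    exact h
  · intro σ _; group
  · intro σ _; group
  · intro σ _
    rw [Representation.ofMulAction_single, ← smul_tabloid, smul_smul, smul_smul]
    congr 1
    · group
    · simp [mul_comm, ← mul_assoc]

/-- The Specht module `S^μ`: the subrepresentation of `M^μ` spanned by all polytabloids. -/
noncomputable def spechtSub (μ : YoungDiagram) (n : ℕ) : Subrepresentation (permModule μ n) where
  toSubmodule := Submodule.span ℂ (Set.range fun t : Tableau μ n => polytabloid t)
  apply_mem_toSubmodule g v hv := by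
    induction hv using Submodule.span_induction with
    | mem x hx =>
      obtain ⟨t, rfl⟩ := hx
      rw [permModule_polytabloid]
      exact Submodule.subset_span ⟨_, rfl⟩
    | zero => simp
    | add x y _ _ hx hy => rw [map_add]; exact Submodule.add_mem _ hx hy
    | smul a x _ hx => rw [map_smul]; exact Submodule.smul_mem _ a hx

/-- The Specht module `S^p` of a partition `p` of `n`, as a representation of the symmetric group
on `n` letters. -/
noncomputable abbrev specht {n : ℕ} (p : n.Partition) :
    Representation ℂ (Equiv.Perm (Fin n)) (spechtSub (diagram p) n).toSubmodule :=
  (spechtSub (diagram p) n).toRepresentation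

/-! ### Matchings -/

/-- A set of edges of `G` is a matching if distinct edges in it are disjoint. -/
def IsMatching {V : Type*} (G : SimpleGraph V) (M : Finset (Sym2 V)) : Prop :=
  (∀ e ∈ M, e ∈ G.edgeSet) ∧ ∀ e ∈ M, ∀ e' ∈ M, e ≠ e' → ∀ v, v ∈ e → v ∉ e'

/-- The `k`-matchings (matchings with `k` edges) in the complete graph `K_{2k}`. -/
@[ext]
structure Matchings (k : ℕ) where
  edges : Finset (Sym2 (Fin (2 * k)))
  isMatching : IsMatching ⊤ edges
  card_edges : edges.card = k

theorem IsMatching.image {V : Type*} [DecidableEq V] {M : Finset (Sym2 V)}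
    (h : IsMatching ⊤ M) (σ : Equiv.Perm V) : IsMatching ⊤ (M.image (Sym2.map σ)) := by
  refine ⟨fun e he => ?_, fun e he e' he' hne v hv hv' => ?_⟩
  · obtain ⟨d, hd, rfl⟩ := Finset.mem_image.1 he
    have := h.1 d hd
    induction d using Sym2.ind with
    | _ x y => simpa using this
  · obtain ⟨d, hd, rfl⟩ := Finset.mem_image.1 he
    obtain ⟨d', hd', rfl⟩ := Finset.mem_image.1 he'
    obtain ⟨a, ha, rfl⟩ := Sym2.mem_map.1 hv
    obtain ⟨b, hb, hab⟩ := Sym2.mem_map.1 hv'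
    obtain rfl := σ.injective hab
    exact h.2 d hd d' hd' (fun e => hne (e ▸ rfl)) b ha hb

/-- The symmetric group acts on matchings by permuting the vertices. -/
instance (k : ℕ) : MulAction (Equiv.Perm (Fin (2 * k))) (Matchings k) where
  smul σ M := ⟨M.edges.image (Sym2.map σ), M.isMatching.image σ, by
    rw [Finset.card_image_of_injective _ (Sym2.map.injective σ.injective), M.card_edges]⟩
  one_smul M := Matchings.ext (by
    change M.edges.image (Sym2.map id) = M.edges
    simp)
  mul_smul σ τ M := Matchings.ext (by
    change M.edges.image (Sym2.map (σ ∘ τ)) = (M.edges.image (Sym2.map τ)).image (Sym2.map σ)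
    rw [Finset.image_image, Sym2.map_comp])

/-- The module `ℂ[S]`, where `S` is the set of `k`-matchings in `K_{2k}`. -/
noncomputable abbrev matchingModule (k : ℕ) :
    Representation ℂ (Equiv.Perm (Fin (2 * k))) ℂ[Matchings k] :=
  Representation.ofMulAction ℂ (Equiv.Perm (Fin (2 * k))) (Matchings k)

/-! ### The map from tabloids to matchings -/

/-- The set of entries in row `i` of a tabloid. -/
def Tabloid.row {μ : YoungDiagram} {n : ℕ} (T : Tabloid μ n) (i : ℕ) : Finset (Fin n) :=
  Finset.univ.filter fun x => T.rowOf x = i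

/-- The perfect matchings of a finite vertex set `R`: the matchings with edges inside `R` that have
`|R| / 2` edges. -/
def IsPerfectMatchingOf {V : Type*} (R : Finset V) (M : Finset (Sym2 V)) : Prop :=
  IsMatching ⊤ M ∧ (∀ e ∈ M, ∀ v ∈ e, v ∈ R) ∧ 2 * M.card = R.card

/-- A choice of a perfect matching of each row of the tabloid `T`. -/
@[ext]
structure RowMatchings {μ : YoungDiagram} {n : ℕ} (T : Tabloid μ n) where
  /-- The matching of the `i`-th row; the rows are indexed from `0`, and `μ.colLen 0` is their
  number. -/
  matching : Fin (μ.colLen 0) → Finset (Sym2 (Fin n))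
  isPerfect : ∀ i : Fin (μ.colLen 0), IsPerfectMatchingOf (T.row i) (matching i)

noncomputable instance {μ : YoungDiagram} {n : ℕ} (T : Tabloid μ n) : Fintype (RowMatchings T) :=
  Fintype.ofInjective RowMatchings.matching fun _ _ h => RowMatchings.ext h

theorem Tabloid.lt_colLen {μ : YoungDiagram} {n : ℕ} (T : Tabloid μ n) (x : Fin n) :
    T.rowOf x < μ.colLen 0 := by
  obtain ⟨t, ht⟩ := T.exists_tableau
  rw [← ht, ← YoungDiagram.mem_iff_lt_colLen]
  exact μ.up_left_mem le_rfl (Nat.zero_le _) (t.symm x).2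

theorem RowMatchings.eq_of_mem {μ : YoungDiagram} {n : ℕ} {T : Tabloid μ n} (m : RowMatchings T)
    {i j : Fin (μ.colLen 0)} {e e' : Sym2 (Fin n)} (he : e ∈ m.matching i)
    (he' : e' ∈ m.matching j) {v : Fin n} (hv : v ∈ e) (hv' : v ∈ e') : i = j := by
  have h1 := (m.isPerfect i).2.1 e he v hv
  have h2 := (m.isPerfect j).2.1 e' he' v hv'
  simp only [Tabloid.row, Finset.mem_filter, Finset.mem_univ, true_and] at h1 h2
  exact Fin.ext (h1.symm.trans h2)

theorem Tabloid.sum_card_row {μ : YoungDiagram} {n : ℕ} (T : Tabloid μ n) :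
    ∑ i : Fin (μ.colLen 0), (T.row i).card = n := by
  have h := Finset.card_eq_sum_card_fiberwise (s := (Finset.univ : Finset (Fin n)))
    (t := (Finset.univ : Finset (Fin (μ.colLen 0))))
    (f := fun x => ⟨T.rowOf x, T.lt_colLen x⟩) (fun _ _ => Finset.mem_coe.2 (Finset.mem_univ _))
  rw [Finset.card_univ, Fintype.card_fin] at h
  refine Eq.trans ?_ h.symm
  refine Finset.sum_congr rfl fun i _ => congrArg Finset.card ?_
  ext x
  simp [Tabloid.row, Fin.ext_iff]

/-- The union of perfect matchings of all the rows of a tabloid. -/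
def RowMatchings.union {μ : YoungDiagram} {k : ℕ} {T : Tabloid μ (2 * k)} (m : RowMatchings T) :
    Matchings k where
  edges := Finset.univ.biUnion m.matching
  isMatching := by
    refine ⟨fun e he => ?_, fun e he e' he' hne v hv hv' => ?_⟩
    · obtain ⟨i, -, hi⟩ := Finset.mem_biUnion.1 he
      exact (m.isPerfect i).1.1 e hi
    · obtain ⟨i, -, hi⟩ := Finset.mem_biUnion.1 he
      obtain ⟨j, -, hj⟩ := Finset.mem_biUnion.1 he'
      obtain rfl := m.eq_of_mem hi hj hv hv'
      exact (m.isPerfect i).1.2 e hi e' hj hne v hv hv'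
  card_edges := by
    have hcard : (Finset.univ.biUnion m.matching).card = ∑ i, (m.matching i).card := by
      refine Finset.card_biUnion fun i _ j _ hij => Finset.disjoint_left.2 fun e hi hj => ?_
      induction e using Sym2.ind with
      | _ x y => exact hij (m.eq_of_mem (v := x) hi hj (by simp) (by simp))
    have h2 : 2 * ∑ i, (m.matching i).card = 2 * k := by
      rw [Finset.mul_sum]
      exact (Finset.sum_congr rfl fun i _ => (m.isPerfect i).2.2).trans T.sum_card_row
    omega

/-- The linear map `f : M^μ → ℂ[S]` that sends a tabloid with rows `R_i` to the product over `i` of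
the sums of all perfect matchings of `R_i`, where the product of disjoint matchings is their union.
The product is written in expanded form, as a sum over all choices of a perfect matching of each
row. -/
noncomputable def f (μ : YoungDiagram) (k : ℕ) : ℂ[Tabloid μ (2 * k)] →ₗ[ℂ] ℂ[Matchings k] :=
  (MonoidAlgebra.basis (Tabloid μ (2 * k)) ℂ).constr ℂ fun T =>
    ∑ m : RowMatchings T, MonoidAlgebra.single m.union 1

end SpechtMatching

namespace SpechtMatching

/-! Injectivity comes from column antisymmetrizers, surjectivity from counting endomorphisms.

For a tableau `t` of shape `μ`, the signed sum over its column group kills `M^ν` unless `ν` is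
dominated by `μ`, and it sends `M^μ` into the line spanned by `e_t`. With the invariant Hermitian
form on `M^μ` this gives irreducibility of the Specht module (James). For even `μ`, consider the
matching that pairs columns `2j` and `2j + 1` in every row of `t`. Every column permutation that
contributes to its coefficient in `f(e_t)` is even, so nothing cancels and `f(e_t) ≠ 0`
(`f_polytabloid_ne_zero`). If the images of several Specht elements sum to zero, antisymmetrizing
over tableaux of a dominance-minimal shape among the nonzero ones isolates that component and forces
it to vanish (`spechtSumMap_injective`).

Conversely, two perfect matchings form a bipartite graph, so up to relabelling a pair of them is a
permutation of `k` points up to conjugacy. Hence there are at most as many orbits on pairs as cycle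
types, and doubling the parts turns cycle types into even partitions. So `dim End(ℂ[S])` is at most
the number of even partitions (`finrank_end_le`). The projections onto the embedded summands are
independent endomorphisms, so they already span `End(ℂ[S])`. This leaves no room for a complement or
for a second copy of a summand (`surjective_and_finrank_eq_one`). -/

/-! ### Dominance -/

/-- The number of cells in the first `i` rows of a Young diagram. -/
def rowSum (μ : YoungDiagram) (i : ℕ) : ℕ := (μ.cells.filter fun c => c.1 < i).card

theorem rowSum_succ (μ : YoungDiagram) (i : ℕ) : rowSum μ (i + 1) = rowSum μ i + μ.rowLen i := by
  rw [rowSum, rowSum, YoungDiagram.rowLen_eq_card, ← Finset.card_union_of_disjoint]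
  · congr 1
    ext c
    simp only [Finset.mem_filter, Finset.mem_union, YoungDiagram.mem_row_iff,
      YoungDiagram.mem_cells]
    constructor
    · rintro ⟨h, h'⟩
      rcases Nat.lt_succ_iff_lt_or_eq.1 h' with h' | h'
      · exact Or.inl ⟨h, h'⟩
      · exact Or.inr ⟨h, h'⟩
    · rintro (⟨h, h'⟩ | ⟨h, h'⟩)
      · exact ⟨h, by omega⟩
      · exact ⟨h, by omega⟩
  · rw [Finset.disjoint_left]
    intro c h1 h2
    rw [Finset.mem_filter] at h1
    rw [YoungDiagram.mem_row_iff] at h2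
    omega

/-- The pointwise order on `rowSum` is the dominance order; injectivity makes it antisymmetric on
diagrams. -/
theorem rowSum_injective : Function.Injective rowSum := by
  intro μ ν h
  have hl : ∀ i, μ.rowLen i = ν.rowLen i := fun i => by
    have h1 := rowSum_succ μ i
    have h2 := rowSum_succ ν i
    rw [h] at h1
    omega
  ext ⟨i, j⟩
  rw [YoungDiagram.mem_cells, YoungDiagram.mem_cells, YoungDiagram.mem_iff_lt_rowLen,
    YoungDiagram.mem_iff_lt_rowLen, hl]

theorem Tabloid.card_rowOf_lt {μ : YoungDiagram} {n : ℕ} (T : Tabloid μ n) (i : ℕ) :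
    (Finset.univ.filter fun x => T.rowOf x < i).card = rowSum μ i := by
  obtain ⟨t, ht⟩ := T.exists_tableau
  refine Finset.card_bij (fun x _ => (t.symm x).1) ?_ ?_ ?_
  · intro x hx
    rw [Finset.mem_filter] at hx ⊢
    refine ⟨(t.symm x).2, ?_⟩
    rw [← ht] at hx
    exact hx.2
  · intro x _ y _ h
    exact t.symm.injective (Subtype.ext h)
  · intro c hc
    rw [Finset.mem_filter] at hc
    refine ⟨t ⟨c, hc.1⟩, ?_, by simp⟩
    rw [Finset.mem_filter, ← ht]
    simpa [Tableau.rowOf] using hc.2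

namespace Tableau

variable {μ ν : YoungDiagram} {n : ℕ}

theorem ext_rowOf_colOf (t : Tableau μ n) {x y : Fin n} (h : t.rowOf x = t.rowOf y)
    (h' : t.colOf x = t.colOf y) : x = y :=
  t.symm.injective (Subtype.ext (Prod.ext h h'))

theorem card_col_rowOf_lt (t : Tableau μ n) (c i : ℕ) :
    (Finset.univ.filter fun x => t.rowOf x < i ∧ t.colOf x = c).card = min i (μ.colLen c) := by
  rw [← Finset.card_range (min i _)]
  refine Finset.card_bij (fun x _ => t.rowOf x) ?_ ?_ ?_
  · intro x hx
    rw [Finset.mem_filter] at hx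
    rw [Finset.mem_range, lt_min_iff, ← YoungDiagram.mem_iff_lt_colLen, ← hx.2.2]
    exact ⟨hx.2.1, (t.symm x).2⟩
  · intro x hx y hy h
    rw [Finset.mem_filter] at hx hy
    exact t.ext_rowOf_colOf h (hx.2.2.trans hy.2.2.symm)
  · intro r hr
    rw [Finset.mem_range, lt_min_iff, ← YoungDiagram.mem_iff_lt_colLen] at hr
    refine ⟨t ⟨(r, c), hr.2⟩, Finset.mem_filter.2 ⟨Finset.mem_univ _, ?_⟩, ?_⟩
    · rw [rowOf, colOf, Equiv.symm_apply_apply]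
      exact ⟨hr.1, rfl⟩
    · rw [rowOf, Equiv.symm_apply_apply]

theorem card_col (t : Tableau μ n) (c : ℕ) :
    (Finset.univ.filter fun x => t.colOf x = c).card = μ.colLen c := by
  rw [← min_eq_right (le_refl (μ.colLen c)), ← t.card_col_rowOf_lt]
  congr 1
  ext x
  simp only [Finset.mem_filter, Finset.mem_univ, true_and]
  refine ⟨fun h => ⟨?_, h⟩, fun h => h.2⟩
  rw [← h, ← YoungDiagram.mem_iff_lt_colLen]
  exact (t.symm x).2

/-- No column of `t` contains two entries of the same row of `T`. -/
def Separates (t : Tableau μ n) (T : Tabloid ν n) : Prop :=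
  ∀ x y, T.rowOf x = T.rowOf y → t.colOf x = t.colOf y → x = y

variable {t : Tableau μ n}

/-- The entries of one column of `t` lie in distinct rows of `T`, so at most `i` of them are in the
first `i` rows, and never more than the column length. The tableau `t` itself attains both bounds,
since its columns are filled from the top. -/
theorem Separates.card_le {T : Tabloid ν n} (h : t.Separates T) (c i : ℕ) :
    (Finset.univ.filter fun x => T.rowOf x < i ∧ t.colOf x = c).card ≤
      (Finset.univ.filter fun x => t.rowOf x < i ∧ t.colOf x = c).card := by
  rw [card_col_rowOf_lt, le_min_iff]
  constructor
  · refine (Finset.card_le_card_of_injOn T.rowOf ?_ ?_).trans (Finset.card_range i).le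
    · intro x hx
      simp only [Finset.coe_filter, Set.mem_ofPred_eq] at hx
      simpa using hx.2.1
    · intro x hx y hy hxy
      simp only [Finset.coe_filter, Set.mem_ofPred_eq] at hx hy
      exact h x y hxy (hx.2.2.trans hy.2.2.symm)
  · rw [← t.card_col]
    exact Finset.card_le_card (Finset.monotone_filter_right _ fun _ _ h => h.2)

theorem sum_card_col (t : Tableau μ n) (p : Fin n → Prop) [DecidablePred p] :
    (Finset.univ.filter p).card = ∑ c ∈ Finset.univ.image t.colOf,
      (Finset.univ.filter fun x => p x ∧ t.colOf x = c).card := by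
  rw [Finset.card_eq_sum_card_fiberwise (f := t.colOf) (t := Finset.univ.image t.colOf)]
  · simp only [Finset.filter_filter]
  · intro x _
    simp

theorem Separates.rowSum_le {T : Tabloid ν n} (h : t.Separates T) (i : ℕ) :
    rowSum ν i ≤ rowSum μ i := by
  rw [← T.card_rowOf_lt, ← t.tabloid.card_rowOf_lt, t.sum_card_col, t.sum_card_col]
  exact Finset.sum_le_sum fun c _ => h.card_le c i

/-- For equal shapes the totals over all columns agree, so `card_le` is an equality in each column.
Taking `i` to be the column length puts the whole column into the first `i` rows of `T`. -/
theorem Separates.rowOf_lt {T : Tabloid μ n} (h : t.Separates T) (x : Fin n) :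
    T.rowOf x < μ.colLen (t.colOf x) := by
  have key : ∀ i, ∀ c ∈ Finset.univ.image t.colOf,
      (Finset.univ.filter fun x => T.rowOf x < i ∧ t.colOf x = c).card =
      (Finset.univ.filter fun x => t.rowOf x < i ∧ t.colOf x = c).card := fun i => by
    rw [← Finset.sum_eq_sum_iff_of_le fun c _ => h.card_le c i, ← t.sum_card_col,
      ← t.sum_card_col, T.card_rowOf_lt]
    exact (t.tabloid.card_rowOf_lt i).symm
  have h1 := key (μ.colLen (t.colOf x)) (t.colOf x) (by simp)
  rw [card_col_rowOf_lt, min_self, ← t.card_col] at h1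
  have h2 := Finset.eq_of_subset_of_card_le
    (Finset.monotone_filter_right Finset.univ fun _ _ h => h.2) h1.ge
  have h3 : x ∈ Finset.univ.filter fun y => t.colOf y = t.colOf x := by simp
  rw [← h2, Finset.mem_filter] at h3
  exact h3.2.1.trans_eq (t.card_col _)

/-- If no column of `t` contains two entries of the same row of `T`, then `T = π{t}` for some `π`
in the column group of `t`. -/
theorem Separates.exists_columnGroup {T : Tabloid μ n} (h : t.Separates T) :
    ∃ π ∈ columnGroup t, T = π • t.tabloid := by
  -- Each entry keeps its column in `t` and moves to its row in `T`. The resulting tableau `s` has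
  -- tabloid `T`, and `π` carries `t` to `s`.
  let c : Fin n → {c : ℕ × ℕ // c ∈ μ.cells} := fun x =>
    ⟨(T.rowOf x, t.colOf x), YoungDiagram.mem_iff_lt_colLen.2 (h.rowOf_lt x)⟩
  have hc : Function.Injective c := fun x y hxy =>
    h x y (congrArg (fun c => c.1.1) hxy) (congrArg (fun c => c.1.2) hxy)
  have hb : Function.Bijective c := by
    rw [Fintype.bijective_iff_injective_and_card]
    exact ⟨hc, Fintype.card_congr t.symm⟩
  let s : Tableau μ n := (Equiv.ofBijective c hb).symm
  have hs : ∀ x, s.symm x = c x := fun x => rfl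
  refine ⟨t.symm.trans s, ?_, ?_⟩
  · simp only [columnGroup, Finset.mem_filter, Finset.mem_univ, true_and]
    intro x
    have h1 : (c (s (t.symm x))).1.2 = (t.symm x).1.2 := by
      rw [← hs, Equiv.symm_apply_apply]
    exact h1
  · rw [smul_tabloid]
    have h1 : t.perm (t.symm.trans s) = s := by
      ext x
      simp [perm]
    rw [h1]
    ext x
    rfl

end Tableau

/-! ### The column antisymmetrizer -/

section ColAnti

variable {μ ν : YoungDiagram} {n : ℕ} {V W : Type*} [AddCommGroup V] [Module ℂ V]
  [AddCommGroup W] [Module ℂ W]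

/-- The action of the signed sum over the column group of `t` on a representation. -/
noncomputable def colAnti (ρ : Representation ℂ (Equiv.Perm (Fin n)) V) (t : Tableau μ n) :
    V →ₗ[ℂ] V :=
  ∑ σ ∈ columnGroup t, ((Equiv.Perm.sign σ : ℤ) : ℂ) • ρ σ

theorem colAnti_apply (ρ : Representation ℂ (Equiv.Perm (Fin n)) V) (t : Tableau μ n) (v : V) :
    colAnti ρ t v = ∑ σ ∈ columnGroup t, ((Equiv.Perm.sign σ : ℤ) : ℂ) • ρ σ v := by
  simp [colAnti]

theorem map_colAnti {ρ : Representation ℂ (Equiv.Perm (Fin n)) V}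
    {σ : Representation ℂ (Equiv.Perm (Fin n)) W} {φ : V →ₗ[ℂ] W} (h : ρ.IsIntertwiningMap σ φ)
    (t : Tableau μ n) (v : V) : φ (colAnti ρ t v) = colAnti σ t (φ v) := by
  simp [colAnti_apply, h.isIntertwining]

theorem mul_mem_columnGroup {t : Tableau μ n} {σ τ : Equiv.Perm (Fin n)} (hσ : σ ∈ columnGroup t)
    (hτ : τ ∈ columnGroup t) : σ * τ ∈ columnGroup t := by
  simp only [columnGroup, Finset.mem_filter, Finset.mem_univ, true_and] at *
  intro x
  rw [Equiv.Perm.mul_apply, hσ, hτ]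

theorem inv_mem_columnGroup {t : Tableau μ n} {σ : Equiv.Perm (Fin n)} (hσ : σ ∈ columnGroup t) :
    σ⁻¹ ∈ columnGroup t := by
  simp only [columnGroup, Finset.mem_filter, Finset.mem_univ, true_and] at *
  intro x
  have h := hσ (σ⁻¹ x)
  have e : σ (σ⁻¹ x) = x := Equiv.apply_symm_apply σ x
  rw [e] at h
  exact h.symm

/-- Translating by an element `π` of the column group multiplies the antisymmetrization by the sign
of `π`. -/
theorem colAnti_apply_mem (ρ : Representation ℂ (Equiv.Perm (Fin n)) V) (t : Tableau μ n)
    {π : Equiv.Perm (Fin n)} (hπ : π ∈ columnGroup t) (v : V) :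
    colAnti ρ t (ρ π v) = ((Equiv.Perm.sign π : ℤ) : ℂ) • colAnti ρ t v := by
  rw [colAnti_apply, colAnti_apply, Finset.smul_sum]
  refine Finset.sum_bij' (fun σ _ => σ * π) (fun σ _ => σ * π⁻¹) ?_ ?_ ?_ ?_ ?_
  · intro σ hσ
    exact mul_mem_columnGroup hσ hπ
  · intro σ hσ
    exact mul_mem_columnGroup hσ (inv_mem_columnGroup hπ)
  · intro σ _
    group
  · intro σ _
    group
  · intro σ _
    rw [map_mul ρ, Module.End.mul_apply, smul_smul, map_mul]
    congr 1
    rcases Int.units_eq_one_or (Equiv.Perm.sign π) with h | h <;> simp [h]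

/-- The transposition is an odd element of the column group that fixes `v`, so the
antisymmetrization equals its own negative. -/
theorem colAnti_eq_zero (ρ : Representation ℂ (Equiv.Perm (Fin n)) V) (t : Tableau μ n)
    {x y : Fin n} (hxy : x ≠ y) (hc : t.colOf x = t.colOf y) {v : V}
    (hv : ρ (Equiv.swap x y) v = v) : colAnti ρ t v = 0 := by
  have hs : Equiv.swap x y ∈ columnGroup t := by
    simp only [columnGroup, Finset.mem_filter, Finset.mem_univ, true_and]
    intro z
    rw [Equiv.swap_apply_def]
    split_ifs with h1 h2
    · rw [h1, hc]
    · rw [h2, hc]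
    · rfl
  have h := colAnti_apply_mem ρ t hs v
  rw [hv, Equiv.Perm.sign_swap hxy] at h
  simp only [Units.val_neg, Units.val_one, Int.cast_neg, Int.cast_one, neg_smul, one_smul] at h
  have h2 : (2 : ℂ) • colAnti ρ t v = 0 := by
    rw [two_smul]
    nth_rw 1 [h]
    exact neg_add_cancel _
  exact (smul_eq_zero.1 h2).resolve_left two_ne_zero

theorem colAnti_tabloid (t : Tableau μ n) :
    colAnti (permModule μ n) t (MonoidAlgebra.single t.tabloid 1) = polytabloid t := by
  simp [colAnti_apply, polytabloid, Representation.ofMulAction_single]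

theorem colAnti_single_eq_zero {t : Tableau μ n} {T : Tabloid ν n} (h : ¬ t.Separates T) :
    colAnti (permModule ν n) t (MonoidAlgebra.single T 1) = 0 := by
  simp only [Tableau.Separates, not_forall] at h
  obtain ⟨x, y, h1, h2, h3⟩ := h
  refine colAnti_eq_zero _ t h3 h2 ?_
  rw [Representation.ofMulAction_single]
  congr 1
  ext z
  change T.rowOf ((Equiv.swap x y)⁻¹ z) = T.rowOf z
  rw [Equiv.swap_inv, Equiv.swap_apply_def]
  split_ifs with h1 h2
  · rw [h1, ‹T.rowOf x = _›]
  · rw [h2, ‹T.rowOf x = _›]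
  · rfl

theorem colAnti_eq_zero_of_not_rowSum_le (t : Tableau μ n) (h : ¬ rowSum ν ≤ rowSum μ)
    (v : ℂ[Tabloid ν n]) : colAnti (permModule ν n) t v = 0 := by
  suffices H : colAnti (permModule ν n) t = 0 by rw [H, LinearMap.zero_apply]
  refine (MonoidAlgebra.basis (Tabloid ν n) ℂ).ext fun T => ?_
  rw [MonoidAlgebra.basis_apply, LinearMap.zero_apply]
  exact colAnti_single_eq_zero fun hs => h fun i => hs.rowSum_le i

/-- A tabloid that `t` does not separate is killed; any other is `π{t}` with `π` in the column group
and contributes `± e_t`. -/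
theorem colAnti_mem_span (t : Tableau μ n) (v : ℂ[Tabloid μ n]) :
    colAnti (permModule μ n) t v ∈ Submodule.span ℂ {polytabloid t} := by
  induction v using MonoidAlgebra.induction_linear with
  | zero => simp
  | add v w hv hw =>
    rw [map_add]
    exact add_mem hv hw
  | single T a =>
    have ha : MonoidAlgebra.single T a = a • MonoidAlgebra.single T (1 : ℂ) := by simp
    rw [ha, map_smul]
    refine Submodule.smul_mem _ _ ?_
    by_cases h : t.Separates T
    · obtain ⟨π, hπ, rfl⟩ := h.exists_columnGroup
      have h1 := colAnti_apply_mem (permModule μ n) t hπ (MonoidAlgebra.single t.tabloid 1)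
      rw [Representation.ofMulAction_single, colAnti_tabloid] at h1
      rw [h1]
      exact Submodule.smul_mem _ _ (Submodule.mem_span_singleton_self _)
    · rw [colAnti_single_eq_zero h]
      exact zero_mem _

/-! ### Irreducibility of Specht modules -/

instance (μ : YoungDiagram) (n : ℕ) : Finite (Tabloid μ n) :=
  Finite.of_surjective (fun t : Tableau μ n => t.tabloid) fun T => by
    obtain ⟨t, ht⟩ := T.exists_tableau
    exact ⟨t, Tabloid.ext ht⟩

/-- The right side is the inner product of `u` with `e_t`. Hence a vector killed by the
antisymmetrizer of `t` is orthogonal to `e_t`. -/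
theorem coeff_colAnti (t : Tableau μ n) (u : ℂ[Tabloid μ n]) :
    (colAnti (permModule μ n) t u).coeff t.tabloid =
      ∑ σ ∈ columnGroup t, ((Equiv.Perm.sign σ : ℤ) : ℂ) * u.coeff (σ • t.tabloid) := by
  rw [colAnti_apply, MonoidAlgebra.coeff_sum, Finset.sum_apply']
  refine Finset.sum_bij' (fun σ _ => σ⁻¹) (fun σ _ => σ⁻¹) ?_ ?_ ?_ ?_ ?_
  · exact fun σ hσ => inv_mem_columnGroup hσ
  · exact fun σ hσ => inv_mem_columnGroup hσ
  · simp
  · simp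
  · intro σ _
    simp

/-- An element of the Specht module that is killed by all column antisymmetrizers vanishes. -/
theorem eq_zero_of_colAnti_eq_zero {u : ℂ[Tabloid μ n]} (hu : u ∈ (spechtSub μ n).toSubmodule)
    (h : ∀ t : Tableau μ n, colAnti (permModule μ n) t u = 0) : u = 0 := by
  have := Fintype.ofFinite (Tabloid μ n)
  -- `u` is orthogonal to the whole Specht module, hence to itself. Conjugating the second factor
  -- makes the form positive definite.
  have key : ∀ v ∈ (spechtSub μ n).toSubmodule,
      ∑ T, u.coeff T * (starRingEnd ℂ) (v.coeff T) = 0 := by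
    intro v hv
    induction hv using Submodule.span_induction with
    | mem x hx =>
      obtain ⟨t, rfl⟩ := hx
      have h1 := coeff_colAnti t u
      rw [h] at h1
      simp only [polytabloid, MonoidAlgebra.coeff_sum, Finset.sum_apply', map_sum,
        MonoidAlgebra.coeff_single, Finset.mul_sum]
      rw [Finset.sum_comm]
      refine Eq.trans (Finset.sum_congr rfl fun σ _ => ?_) h1.symm
      classical
      simp [Finsupp.single_apply, apply_ite, mul_comm]
    | zero => simp
    | add x y _ _ hx hy =>
      simp [mul_add, Finset.sum_add_distrib, hx, hy]
    | smul a x _ hx =>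
      have : ∀ T, u.coeff T * (starRingEnd ℂ) ((a • x).coeff T) =
          (starRingEnd ℂ) a * (u.coeff T * (starRingEnd ℂ) (x.coeff T)) := fun T => by
        simp; ring
      rw [Finset.sum_congr rfl fun T _ => this T, ← Finset.mul_sum, hx, mul_zero]
  have h0 := key u hu
  simp only [Complex.mul_conj, ← Complex.ofReal_sum, Complex.ofReal_eq_zero] at h0
  rw [Finset.sum_eq_zero_iff_of_nonneg fun T _ => Complex.normSq_nonneg _] at h0
  ext T
  simpa using h0 T (Finset.mem_univ T)

/-- If all antisymmetrizers kill a submodule `U`, then `U` is zero. Otherwise `U` contains a nonzero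
multiple of some `e_t`, and therefore every polytabloid, because the group permutes tableaux
transitively. -/
theorem spechtSub_isIrreducible (μ : YoungDiagram) (n : ℕ) (t₀ : Tableau μ n)
    (h₀ : polytabloid t₀ ≠ 0) : (spechtSub μ n).toRepresentation.IsIrreducible := by
  have mem (t : Tableau μ n) : polytabloid t ∈ (spechtSub μ n).toSubmodule :=
    Submodule.subset_span ⟨t, rfl⟩
  refine { exists_pair_ne := ⟨⊥, ⊤, fun h => h₀ ?_⟩, eq_bot_or_eq_top := fun U => ?_ }
  · have h1 : (⟨polytabloid t₀, mem t₀⟩ : (spechtSub μ n).toSubmodule) ∈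
        (⊥ : Subrepresentation (spechtSub μ n).toRepresentation) := by
      rw [h]
      exact Submodule.mem_top
    exact congrArg Subtype.val ((Submodule.mem_bot ℂ).1 h1)
  · by_cases hU : ∀ u ∈ U.toSubmodule, ∀ t : Tableau μ n, colAnti (permModule μ n) t u.1 = 0
    · left
      refine Subrepresentation.toSubmodule_injective ((Submodule.eq_bot_iff _).2 fun u hu => ?_)
      exact Subtype.ext (eq_zero_of_colAnti_eq_zero u.2 (hU u hu))
    · right
      push Not at hU
      obtain ⟨u, hu, t, ht⟩ := hU
      have hsub : (spechtSub μ n).toRepresentation.IsIntertwiningMap (permModule μ n)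
          (spechtSub μ n).toSubmodule.subtype := ⟨fun g v => rfl⟩
      have h1 : colAnti (spechtSub μ n).toRepresentation t u ∈ U.toSubmodule := by
        rw [colAnti_apply]
        exact sum_mem fun σ _ => Submodule.smul_mem _ _ (U.apply_mem_toSubmodule σ hu)
      have h2 := map_colAnti hsub t u
      obtain ⟨a, ha⟩ := Submodule.mem_span_singleton.1 (colAnti_mem_span t u.1)
      have ha0 : a ≠ 0 := by
        rintro rfl
        rw [zero_smul] at ha
        exact ht ha.symm
      have h3 : (⟨polytabloid t, mem t⟩ : (spechtSub μ n).toSubmodule) ∈ U.toSubmodule := by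
        have : (⟨polytabloid t, mem t⟩ : (spechtSub μ n).toSubmodule) =
            a⁻¹ • colAnti (spechtSub μ n).toRepresentation t u := by
          refine Subtype.ext ?_
          change polytabloid t = a⁻¹ • (spechtSub μ n).toSubmodule.subtype _
          rw [h2, Submodule.subtype_apply, ← ha, smul_smul, inv_mul_cancel₀ ha0, one_smul]
        rw [this]
        exact Submodule.smul_mem _ _ h1
      have h4 : ∀ s : Tableau μ n,
          (⟨polytabloid s, mem s⟩ : (spechtSub μ n).toSubmodule) ∈ U.toSubmodule := fun s => by
        have h5 := U.apply_mem_toSubmodule (t.symm.trans s) h3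
        convert h5 using 1
        refine Subtype.ext ?_
        change polytabloid s = permModule μ n (t.symm.trans s) (polytabloid t)
        rw [permModule_polytabloid]
        congr 1
        ext x
        simp [Tableau.perm]
      refine Subrepresentation.toSubmodule_injective ((Submodule.eq_top_iff').2 fun u => ?_)
      have h6 : (spechtSub μ n).toSubmodule ≤
          U.toSubmodule.map (spechtSub μ n).toSubmodule.subtype :=
        Submodule.span_le.2 (by
          rintro _ ⟨s, rfl⟩
          exact ⟨_, h4 s, rfl⟩)
      obtain ⟨w, hw, hwu⟩ := h6 u.2
      rwa [← Subtype.ext hwu]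

end ColAnti

/-! ### Equivariance of the map to matchings -/

theorem f_single (μ : YoungDiagram) (k : ℕ) (T : Tabloid μ (2 * k)) :
    f μ k (MonoidAlgebra.single T 1) =
      ∑ m : RowMatchings T, MonoidAlgebra.single m.union 1 := by
  rw [← MonoidAlgebra.basis_apply, f, Module.Basis.constr_basis]

theorem sym2_map_map_of_inv {V : Type*} [DecidableEq V] {g h : Equiv.Perm V} (H : h * g = 1)
    (M : Finset (Sym2 V)) : (M.image (Sym2.map g)).image (Sym2.map h) = M := by
  have e : (h : V → V) ∘ g = id := by
    rw [← Equiv.Perm.coe_mul, H, Equiv.Perm.coe_one]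
  rw [Finset.image_image, ← Sym2.map_comp, e, Sym2.map_id, Finset.image_id]

/-- Permuting the entries of a tabloid and of its row matchings. -/
def RowMatchings.map {μ : YoungDiagram} {n : ℕ} {T T' : Tabloid μ n} (g : Equiv.Perm (Fin n))
    (h : T' = g • T) (m : RowMatchings T) : RowMatchings T' where
  matching i := (m.matching i).image (Sym2.map g)
  isPerfect i := by
    have hi := m.isPerfect i
    refine ⟨hi.1.image g, ?_, ?_⟩
    · intro e he v hv
      obtain ⟨d, hd, rfl⟩ := Finset.mem_image.1 he
      obtain ⟨a, ha, rfl⟩ := Sym2.mem_map.1 hv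
      have h1 := hi.2.1 d hd a ha
      simp only [Tabloid.row, Finset.mem_filter, Finset.mem_univ, true_and] at h1 ⊢
      rw [h, ← h1]
      exact congrArg T.rowOf (Equiv.symm_apply_apply g a)
    · rw [Finset.card_image_of_injective _ (Sym2.map.injective g.injective), hi.2.2]
      refine Finset.card_bij (fun x _ => g x) ?_ ?_ ?_
      · intro x hx
        simp only [Tabloid.row, Finset.mem_filter, Finset.mem_univ, true_and] at hx ⊢
        rw [h, ← hx]
        exact congrArg T.rowOf (Equiv.symm_apply_apply g x)
      · intro x _ y _ hxy
        exact g.injective hxy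
      · intro x hx
        simp only [Tabloid.row, Finset.mem_filter, Finset.mem_univ, true_and] at hx
        refine ⟨g⁻¹ x, ?_, Equiv.apply_symm_apply g x⟩
        simp only [Tabloid.row, Finset.mem_filter, Finset.mem_univ, true_and]
        rw [← hx, h]
        rfl

theorem RowMatchings.union_map {μ : YoungDiagram} {k : ℕ} {T T' : Tabloid μ (2 * k)}
    (g : Equiv.Perm (Fin (2 * k))) (h : T' = g • T) (m : RowMatchings T) :
    (m.map g h).union = g • m.union := by
  refine Matchings.ext ?_
  change Finset.univ.biUnion (fun i => (m.matching i).image (Sym2.map g)) =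
    (Finset.univ.biUnion m.matching).image (Sym2.map g)
  rw [Finset.biUnion_image]

theorem f_isIntertwiningMap (μ : YoungDiagram) (k : ℕ) :
    (permModule μ (2 * k)).IsIntertwiningMap (matchingModule k) (f μ k) := by
  refine ⟨fun g v => ?_⟩
  suffices H : f μ k ∘ₗ permModule μ (2 * k) g = matchingModule k g ∘ₗ f μ k from
    LinearMap.congr_fun H v
  refine (MonoidAlgebra.basis (Tabloid μ (2 * k)) ℂ).ext fun T => ?_
  rw [MonoidAlgebra.basis_apply, LinearMap.comp_apply, LinearMap.comp_apply,
    Representation.ofMulAction_single, f_single, f_single, map_sum]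
  -- `RowMatchings.map` takes the target tabloid with an equation, so the inverse lands in the
  -- matchings of `T` itself and not of `g⁻¹ • g • T`.
  refine (Finset.sum_bij' (fun m _ => m.map g rfl)
    (fun m _ => m.map g⁻¹ (inv_smul_smul g T).symm) ?_ ?_ ?_ ?_ ?_).symm
  · exact fun _ _ => Finset.mem_univ _
  · exact fun _ _ => Finset.mem_univ _
  · intro m _
    exact RowMatchings.ext (funext fun i => sym2_map_map_of_inv (inv_mul_cancel g) _)
  · intro m _
    exact RowMatchings.ext (funext fun i => sym2_map_map_of_inv (mul_inv_cancel g) _)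
  · intro m _
    rw [Representation.ofMulAction_single, RowMatchings.union_map]

/-! ### Matchings and involutions -/

/-- The edges `{x, α x}` for `x` in `R`. -/
def pairSet {V : Type*} [DecidableEq V] (α : V → V) (R : Finset V) : Finset (Sym2 V) :=
  R.image fun x => s(x, α x)

theorem isPerfectMatchingOf_pairSet {V : Type*} [DecidableEq V] {α : V → V}
    (h2 : Function.Involutive α) (h1 : ∀ x, α x ≠ x) {R : Finset V} (hR : ∀ x ∈ R, α x ∈ R) :
    IsPerfectMatchingOf R (pairSet α R) := by
  have key : ∀ x v, v ∈ s(x, α x) → s(x, α x) = s(v, α v) := by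
    intro x v hv
    rcases Sym2.mem_iff.1 hv with rfl | rfl
    · rfl
    · rw [h2 x, Sym2.eq_swap]
  refine ⟨⟨?_, ?_⟩, ?_, ?_⟩
  · intro e he
    obtain ⟨x, -, rfl⟩ := Finset.mem_image.1 he
    simpa using (h1 x).symm
  · intro e he e' he' hne v hv hv'
    obtain ⟨x, -, rfl⟩ := Finset.mem_image.1 he
    obtain ⟨y, -, rfl⟩ := Finset.mem_image.1 he'
    exact hne ((key x v hv).trans (key y v hv').symm)
  · intro e he v hv
    obtain ⟨x, hx, rfl⟩ := Finset.mem_image.1 he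
    rcases Sym2.mem_iff.1 hv with rfl | rfl
    · exact hx
    · exact hR x hx
  -- Each edge comes from exactly two elements of `R`, namely its ends `x` and `α x`.
  · rw [Finset.card_eq_sum_card_image (fun x => s(x, α x)) R, pairSet]
    rw [Finset.sum_const_nat (m := 2), mul_comm]
    intro e he
    obtain ⟨x, hx, rfl⟩ := Finset.mem_image.1 he
    have : (R.filter fun y => s(y, α y) = s(x, α x)) = {x, α x} := by
      ext y
      simp only [Finset.mem_filter, Finset.mem_insert, Finset.mem_singleton]
      constructor
      · rintro ⟨-, hy⟩
        rw [← Sym2.mem_iff, ← hy]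
        exact Sym2.mem_mk_left _ _
      · rintro (rfl | rfl)
        · exact ⟨hx, rfl⟩
        · exact ⟨hR x hx, (key x _ (Sym2.mem_mk_right _ _)).symm⟩
    rw [this, Finset.card_pair (h1 x).symm]

theorem RowMatchings.rowOf_eq {μ : YoungDiagram} {k : ℕ} {T : Tabloid μ (2 * k)}
    (m : RowMatchings T) {x y : Fin (2 * k)} (h : s(x, y) ∈ m.union.edges) :
    T.rowOf x = T.rowOf y := by
  obtain ⟨i, -, hi⟩ := Finset.mem_biUnion.1 h
  have hx := (m.isPerfect i).2.1 _ hi x (Sym2.mem_mk_left _ _)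
  have hy := (m.isPerfect i).2.1 _ hi y (Sym2.mem_mk_right _ _)
  simp only [Tabloid.row, Finset.mem_filter, Finset.mem_univ, true_and] at hx hy
  rw [hx, hy]

/-! ### The image of a polytabloid is nonzero -/

/-- The involution of `ℕ` that exchanges `2j` and `2j + 1`. -/
def partner (j : ℕ) : ℕ := if j % 2 = 0 then j + 1 else j - 1

theorem partner_partner (j : ℕ) : partner (partner j) = j := by
  unfold partner
  split_ifs <;> omega

theorem partner_ne (j : ℕ) : partner j ≠ j := by
  unfold partner
  split_ifs <;> omega

theorem even_partner (j : ℕ) : Even (partner j) ↔ ¬ Even j := by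
  unfold partner
  rw [Nat.even_iff, Nat.even_iff]
  split_ifs <;> omega

theorem partner_lt {j l : ℕ} (h : j < l) (hl : Even l) : partner j < l := by
  rw [Nat.even_iff] at hl
  unfold partner
  split_ifs <;> omega

namespace Tableau

variable {μ : YoungDiagram} {n : ℕ} (hμ : ∀ i, Even (μ.rowLen i)) (t : Tableau μ n)

/-- The neighbour of an entry in its row, if the columns `2j` and `2j + 1` are paired. -/
def mate (x : Fin n) : Fin n :=
  t ⟨(t.rowOf x, partner (t.colOf x)), YoungDiagram.mem_iff_lt_rowLen.2
    (partner_lt (YoungDiagram.mem_iff_lt_rowLen.1 (t.symm x).2) (hμ _))⟩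

theorem rowOf_mate (x : Fin n) : t.rowOf (t.mate hμ x) = t.rowOf x := by
  rw [mate, rowOf, Equiv.symm_apply_apply]

theorem colOf_mate (x : Fin n) : t.colOf (t.mate hμ x) = partner (t.colOf x) := by
  rw [mate, colOf, Equiv.symm_apply_apply]

theorem mate_involutive : Function.Involutive (t.mate hμ) := fun x =>
  t.ext_rowOf_colOf (by rw [rowOf_mate, rowOf_mate])
    (by rw [colOf_mate, colOf_mate, partner_partner])

theorem mate_ne (x : Fin n) : t.mate hμ x ≠ x := fun h =>
  partner_ne (t.colOf x) (by rw [← colOf_mate hμ, h])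

/-- The matching of the rows of `t` that pairs the columns `2j` and `2j + 1`. -/
def mateMatchings : RowMatchings t.tabloid where
  matching i := pairSet (t.mate hμ) (t.tabloid.row i)
  isPerfect i := isPerfectMatchingOf_pairSet (t.mate_involutive hμ) (t.mate_ne hμ) (by
    intro x hx
    simp only [Tabloid.row, Finset.mem_filter, Finset.mem_univ, true_and] at hx ⊢
    exact (t.rowOf_mate hμ x).trans hx)

/-- A column permutation preserves the entries in even columns and those in odd columns. `mate`
exchanges the two sets and conjugates one restriction of `σ` into the other, so the two signs agree
and their product is `1`. -/
theorem sign_eq_one_of_commute {σ : Equiv.Perm (Fin n)} (hσ : σ ∈ columnGroup t)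
    (h : ∀ x, σ (t.mate hμ x) = t.mate hμ (σ x)) : Equiv.Perm.sign σ = 1 := by
  simp only [columnGroup, Finset.mem_filter, Finset.mem_univ, true_and] at hσ
  let p : Fin n → Prop := fun x => Even (t.colOf x)
  have hp : ∀ x, p (σ x) ↔ p x := fun x => by simp only [p, hσ]
  have hm : ∀ x, p (t.mate hμ x) ↔ ¬ p x := fun x => by
    simp only [p, colOf_mate, even_partner]
  let e : {x // p x} ≃ {x // ¬ p x} :=
    { toFun := fun x => ⟨t.mate hμ x, fun h => (hm x).1 h x.2⟩
      invFun := fun x => ⟨t.mate hμ x, (hm x).2 x.2⟩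
      left_inv := fun x => Subtype.ext (t.mate_involutive hμ x)
      right_inv := fun x => Subtype.ext (t.mate_involutive hμ x) }
  have h1 : σ = (σ.subtypePerm hp).subtypeCongr (σ.subtypePerm fun x => not_congr (hp x)) := by
    ext x
    by_cases hx : p x
    · rw [Equiv.Perm.subtypeCongr.left_apply _ _ hx]
      simp
    · rw [Equiv.Perm.subtypeCongr.right_apply _ _ hx]
      simp
  have h2 : Equiv.Perm.sign (σ.subtypePerm hp) =
      Equiv.Perm.sign (σ.subtypePerm fun x => not_congr (hp x)) :=
    Equiv.Perm.sign_eq_sign_of_equiv _ _ e fun x => Subtype.ext (h x).symm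
  rw [h1, Equiv.Perm.sign_subtypeCongr, h2, Int.units_mul_self]

end Tableau

/-- Each edge `{x, mate x}` lies in one row of `σ{t}`, so `σ⁻¹` sends its ends into a common row of
`t`. Since `σ⁻¹` keeps columns, it commutes with `mate`. -/
theorem sign_eq_one_of_union_eq {μ : YoungDiagram} {k : ℕ} (hμ : ∀ i, Even (μ.rowLen i))
    (t : Tableau μ (2 * k)) {σ : Equiv.Perm (Fin (2 * k))} (hσ : σ ∈ columnGroup t)
    (m : RowMatchings (σ • t.tabloid)) (hm : m.union = (t.mateMatchings hμ).union) :
    Equiv.Perm.sign σ = 1 := by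
  rw [← inv_inv σ, Equiv.Perm.sign_inv]
  refine t.sign_eq_one_of_commute hμ (inv_mem_columnGroup hσ) fun x => ?_
  have hc := inv_mem_columnGroup hσ
  simp only [columnGroup, Finset.mem_filter, Finset.mem_univ, true_and] at hc
  refine t.ext_rowOf_colOf ?_ ?_
  · rw [t.rowOf_mate]
    refine (m.rowOf_eq (x := x) (y := t.mate hμ x) ?_).symm
    rw [hm]
    refine Finset.mem_biUnion.2 ⟨⟨t.rowOf x, t.tabloid.lt_colLen x⟩, Finset.mem_univ _, ?_⟩
    refine Finset.mem_image.2 ⟨x, ?_, rfl⟩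
    simp only [Tabloid.row, Finset.mem_filter, Finset.mem_univ, true_and]
    rfl
  · rw [t.colOf_mate, hc, hc, t.colOf_mate]

theorem f_polytabloid_ne_zero {μ : YoungDiagram} {k : ℕ} (hμ : ∀ i, Even (μ.rowLen i))
    (t : Tableau μ (2 * k)) : f μ k (polytabloid t) ≠ 0 := by
  classical
  intro h0
  let M := (t.mateMatchings hμ).union
  let N : Equiv.Perm (Fin (2 * k)) → ℕ := fun σ =>
    (Finset.univ.filter fun m : RowMatchings (σ • t.tabloid) => m.union = M).card
  -- Only permutations of sign `1` contribute, so the signed coefficient is a plain count, to which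
  -- the identity contributes at least one.
  have h1 : (f μ k (polytabloid t)).coeff M = ((∑ σ ∈ columnGroup t, N σ : ℕ) : ℂ) := by
    rw [polytabloid, map_sum, MonoidAlgebra.coeff_sum, Finset.sum_apply', Nat.cast_sum]
    refine Finset.sum_congr rfl fun σ hσ => ?_
    have e : MonoidAlgebra.single (σ • t.tabloid) ((Equiv.Perm.sign σ : ℤ) : ℂ) =
      ((Equiv.Perm.sign σ : ℤ) : ℂ) • MonoidAlgebra.single (σ • t.tabloid) (1 : ℂ) := by simp
    rw [e, map_smul, f_single, MonoidAlgebra.coeff_smul_apply, MonoidAlgebra.coeff_sum,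
      Finset.sum_apply']
    have e2 : ∑ m : RowMatchings (σ • t.tabloid), (MonoidAlgebra.single m.union (1 : ℂ)).coeff M =
        (N σ : ℂ) := by
      simp [N, MonoidAlgebra.coeff_single, Finsupp.single_apply, Finset.sum_boole]
    rw [e2]
    by_cases hN : N σ = 0
    · rw [hN]
      simp
    · obtain ⟨m, hm⟩ := Finset.card_pos.1 (Nat.pos_of_ne_zero hN)
      rw [sign_eq_one_of_union_eq hμ t hσ m (Finset.mem_filter.1 hm).2]
      simp
  rw [h0] at h1
  have h2 : ∑ σ ∈ columnGroup t, N σ = 0 := by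
    have : ((∑ σ ∈ columnGroup t, N σ : ℕ) : ℂ) = 0 := by
      rw [← h1]
      rfl
    exact_mod_cast this
  have h3 := (Finset.sum_eq_zero_iff.1 h2) 1 (by simp [columnGroup])
  have h4 := (Finset.card_eq_zero.1 h3)
  have h5 : (t.mateMatchings hμ).map 1 rfl ∈
      (Finset.univ.filter fun m : RowMatchings ((1 : Equiv.Perm (Fin (2 * k))) • t.tabloid) =>
        m.union = M) := by
    rw [Finset.mem_filter, RowMatchings.union_map]
    exact ⟨Finset.mem_univ _, one_smul _ _⟩
  rw [h4] at h5
  simp at h5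

theorem even_rowLen_diagram {n : ℕ} {p : n.Partition} (hp : ∀ i ∈ p.parts, Even i) (i : ℕ) :
    Even ((diagram p).rowLen i) := by
  by_cases hi : i < (p.parts.sort (· ≥ ·)).length
  · have h := YoungDiagram.rowLen_ofRowLens
      (hw := (p.parts.pairwise_sort (· ≥ ·)).sortedGE) ⟨i, hi⟩
    change (diagram p).rowLen i = _ at h
    rw [h]
    exact hp _ ((Multiset.mem_sort _).1 (List.get_mem _ _))
  · have h : (diagram p).rowLen i = 0 := by
      by_contra h
      have h1 : (i, 0) ∈ diagram p := YoungDiagram.mem_iff_lt_rowLen.2 (Nat.pos_of_ne_zero h)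
      obtain ⟨h2, -⟩ := YoungDiagram.mem_ofRowLens.1 h1
      exact hi h2
    rw [h]
    exact Even.zero

theorem diagram_injective {n : ℕ} : Function.Injective (diagram (n := n)) := by
  intro p q h
  have hp : ∀ p : n.Partition, (diagram p).rowLens = p.parts.sort (· ≥ ·) := fun p =>
    YoungDiagram.rowLens_ofRowLens_eq_self fun x hx => p.parts_pos ((Multiset.mem_sort _).1 hx)
  have h1 := hp p
  rw [h, hp q] at h1
  refine Nat.Partition.ext ?_
  rw [← Multiset.sort_eq p.parts (· ≥ ·), ← h1, Multiset.sort_eq]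

/-! ### Injectivity on the sum of the Specht modules -/

/-- Antisymmetrizing `u` gives `a • e_t`, whose image `a • f(e_t)` vanishes only if `a = 0`. So
vanishing can be tested after applying `f`. -/
theorem eq_zero_of_f_colAnti_eq_zero {μ : YoungDiagram} {k : ℕ} (hμ : ∀ i, Even (μ.rowLen i))
    {u : ℂ[Tabloid μ (2 * k)]} (hu : u ∈ (spechtSub μ (2 * k)).toSubmodule)
    (h : ∀ t : Tableau μ (2 * k), colAnti (matchingModule k) t (f μ k u) = 0) : u = 0 := by
  refine eq_zero_of_colAnti_eq_zero hu fun t => ?_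
  obtain ⟨a, ha⟩ := Submodule.mem_span_singleton.1 (colAnti_mem_span t u)
  have h1 := h t
  rw [← map_colAnti (f_isIntertwiningMap μ k), ← ha, map_smul, smul_eq_zero] at h1
  rw [← ha, h1.resolve_right (f_polytabloid_ne_zero hμ t), zero_smul]

theorem f_injective_on_specht {μ : YoungDiagram} {k : ℕ} (hμ : ∀ i, Even (μ.rowLen i)) :
    Function.Injective fun v : (spechtSub μ (2 * k)).toSubmodule => f μ k v.1 := by
  refine (injective_iff_map_eq_zero (f μ k ∘ₗ (spechtSub μ (2 * k)).toSubmodule.subtype)).2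
    fun v hv => Subtype.ext (eq_zero_of_f_colAnti_eq_zero hμ v.2 fun t => ?_)
  change f μ k v.1 = 0 at hv
  rw [hv, map_zero]

/-- The linear map on the direct sum of the Specht modules of even partitions that equals `f` on
each summand. -/
noncomputable def spechtSumMap (k : ℕ) :
    (⨁ p : EvenPartition k, (spechtSub (diagram p.1) (2 * k)).toSubmodule) →ₗ[ℂ]
      ℂ[Matchings k] :=
  DirectSum.toModule ℂ (EvenPartition k) _ fun p =>
    f (diagram p.1) k ∘ₗ (spechtSub (diagram p.1) (2 * k)).toSubmodule.subtype

theorem spechtSumMap_lof (k : ℕ) (p : EvenPartition k)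
    (v : (spechtSub (diagram p.1) (2 * k)).toSubmodule) :
    spechtSumMap k (DirectSum.lof ℂ (EvenPartition k)
      (fun q => (spechtSub (diagram q.1) (2 * k)).toSubmodule) p v) = f (diagram p.1) k v.1 := by
  rw [spechtSumMap, DirectSum.toModule_lof]
  rfl

theorem spechtSumMap_apply (k : ℕ)
    (v : ⨁ p : EvenPartition k, (spechtSub (diagram p.1) (2 * k)).toSubmodule) :
    spechtSumMap k v = ∑ p, f (diagram p.1) k (v p).1 := by
  conv_lhs => rw [← DirectSum.sum_univ_of v]
  rw [map_sum]
  exact Finset.sum_congr rfl fun p _ => spechtSumMap_lof k p (v p)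

theorem spechtSumMap_injective (k : ℕ) : Function.Injective (spechtSumMap k) := by
  classical
  refine (injective_iff_map_eq_zero _).2 fun v hv => ?_
  by_contra hne
  have hs : (Finset.univ.filter fun p : EvenPartition k => v p ≠ 0).Nonempty := by
    by_contra hs
    rw [Finset.not_nonempty_iff_eq_empty, Finset.filter_eq_empty_iff] at hs
    exact hne (DFinsupp.ext fun p => not_not.1 (hs (Finset.mem_univ p)))
  -- By minimality no other shape `q` in the support is dominated by `p`, so tableaux of shape `p`
  -- antisymmetrize every other component to zero.
  obtain ⟨p, hp, hmin⟩ := Finset.exists_minimalFor (fun p : EvenPartition k => rowSum (diagram p.1))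
    _ hs
  rw [Finset.mem_filter] at hp
  refine hp.2 (Subtype.ext (eq_zero_of_f_colAnti_eq_zero (even_rowLen_diagram p.2) (v p).2
    fun t => ?_))
  rw [spechtSumMap_apply] at hv
  have h1 := congrArg (colAnti (matchingModule k) t) hv
  rw [map_sum, map_zero, Finset.sum_eq_single p] at h1
  · exact h1
  · intro q _ hqp
    by_cases hq : v q = 0
    · rw [hq]
      simp
    · rw [← map_colAnti (f_isIntertwiningMap _ k), colAnti_eq_zero_of_not_rowSum_le, map_zero]
      intro hle
      have hge := hmin (Finset.mem_filter.2 ⟨Finset.mem_univ q, hq⟩) hle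
      exact hqp (Subtype.ext (diagram_injective (rowSum_injective (le_antisymm hle hge))))
  · exact fun h => absurd (Finset.mem_univ p) h

theorem spechtSumMap_isIntertwiningMap (k : ℕ) :
    (Representation.directSum fun p : EvenPartition k => specht p.1).IsIntertwiningMap
      (matchingModule k) (spechtSumMap k) := by
  refine ⟨fun g v => ?_⟩
  rw [spechtSumMap_apply, spechtSumMap_apply, map_sum]
  refine Finset.sum_congr rfl fun p _ => ?_
  rw [← (f_isIntertwiningMap (diagram p.1) k).isIntertwining]
  rfl

/-! ### Pairs of perfect matchings -/

/-- `k` disjoint edges cover `2k` vertices, which is all of them. -/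
theorem Matchings.exists_mem_edges {k : ℕ} (M : Matchings k) (x : Fin (2 * k)) :
    ∃ y, s(x, y) ∈ M.edges := by
  have hdisj : (M.edges : Set (Sym2 (Fin (2 * k)))).PairwiseDisjoint Sym2.toFinset := by
    intro e he e' he' hne
    refine Finset.disjoint_left.2 fun v hv hv' => ?_
    exact M.isMatching.2 e he e' he' hne v (Sym2.mem_toFinset.1 hv) (Sym2.mem_toFinset.1 hv')
  have hcard : (M.edges.biUnion Sym2.toFinset).card = 2 * k := by
    rw [Finset.card_biUnion hdisj, Finset.sum_const_nat (m := 2), M.card_edges, mul_comm]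
    intro e he
    exact Sym2.card_toFinset_of_not_isDiag e
      (SimpleGraph.not_isDiag_of_mem_edgeSet _ (M.isMatching.1 e he))
  have huniv : M.edges.biUnion Sym2.toFinset = Finset.univ := by
    rw [← Finset.card_eq_iff_eq_univ, hcard, Fintype.card_fin]
  have hx : x ∈ M.edges.biUnion Sym2.toFinset := huniv ▸ Finset.mem_univ x
  obtain ⟨e, he, hxe⟩ := Finset.mem_biUnion.1 hx
  obtain ⟨y, rfl⟩ := Sym2.mem_toFinset.1 hxe
  exact ⟨y, he⟩

theorem Matchings.exists_involution {k : ℕ} (M : Matchings k) :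
    ∃ a : Equiv.Perm (Fin (2 * k)), a * a = 1 ∧ (∀ x, a x ≠ x) ∧
      M.edges = pairSet a Finset.univ := by
  choose a ha using M.exists_mem_edges
  have huniq : ∀ {x y}, s(x, y) ∈ M.edges → y = a x := fun {x y} h => by
    by_contra hne
    refine M.isMatching.2 _ h _ (ha x) (fun h' => hne ?_) x (Sym2.mem_mk_left _ _)
      (Sym2.mem_mk_left _ _)
    exact Sym2.congr_right.1 h'
  have hinv : Function.Involutive a := fun x => (huniq (by rw [Sym2.eq_swap]; exact ha x)).symm
  refine ⟨hinv.toPerm, Equiv.ext hinv, fun x hx => ?_, ?_⟩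
  · exact (M.isMatching.1 _ (ha x)) hx.symm
  · ext e
    induction e using Sym2.ind with
    | _ x y =>
      constructor
      · intro h
        rw [huniq h]
        exact Finset.mem_image.2 ⟨x, Finset.mem_univ _, rfl⟩
      · intro h
        obtain ⟨z, -, hz⟩ := Finset.mem_image.1 h
        rw [← hz]
        exact ha z

/-- The graph formed by two perfect matchings, given by fixed-point-free involutions `a` and `b`,
is bipartite. -/
theorem exists_coloring {V : Type*} (a b : Equiv.Perm V) (ha : a * a = 1) (hb : b * b = 1)
    (ha' : ∀ x, a x ≠ x) (hb' : ∀ x, b x ≠ x) :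
    ∃ c : V → Bool, ∀ x, c (a x) = !c x ∧ c (b x) = !c x := by
  classical
  have hai : a⁻¹ = a := inv_eq_of_mul_eq_one_left ha
  have hbi : b⁻¹ = b := inv_eq_of_mul_eq_one_left hb
  have haa : ∀ x, a (a x) = x := fun x => DFunLike.congr_fun ha x
  have hbb : ∀ x, b (b x) = x := fun x => DFunLike.congr_fun hb x
  -- The dihedral relation: `a` inverts `a * b`.
  have hconj : ∀ m : ℤ, a * (a * b) ^ m = (a * b) ^ (-m) * a := fun m => by
    have h1 : a * (a * b) * a⁻¹ = (a * b)⁻¹ := by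
      rw [mul_inv_rev, hai, hbi, ← mul_assoc, ha, one_mul]
    rw [zpow_neg, ← inv_zpow, ← h1, conj_zpow, hai, mul_assoc _ a a, ha, mul_one]
  -- If `(a * b) ^ n` takes `x` to `a x`, then `(a * b) ^ m` takes `x` to a fixed point of `a` when
  -- `n = 2m`, and of `b` when `n = 2m + 1`.
  have hne : ∀ x, ¬ (a * b).SameCycle x (a x) := by
    rintro x ⟨n, hn⟩
    obtain ⟨m, rfl | rfl⟩ := Int.even_or_odd' n
    · refine ha' (((a * b) ^ m) x) ?_
      have h1 : (a * (a * b) ^ m) x = ((a * b) ^ (-m)) (a x) := by rw [hconj]; rfl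
      rw [← Equiv.Perm.mul_apply, h1, ← hn, ← Equiv.Perm.mul_apply, ← zpow_add]
      congr 2
      ring
    · refine hb' (((a * b) ^ m) x) ?_
      have h1 : (a * (a * b) ^ (m + 1)) x = ((a * b) ^ (-(m + 1))) (a x) := by rw [hconj]; rfl
      rw [← hn, ← Equiv.Perm.mul_apply, ← zpow_add] at h1
      have h2 : -(m + 1) + (2 * m + 1) = m := by ring
      rw [h2, add_comm, zpow_add, zpow_one, mul_assoc, ← mul_assoc, ha, one_mul] at h1
      exact h1
  let S := Equiv.Perm.SameCycle.setoid (a * b)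
  let q : V → Quotient S := Quotient.mk S
  -- `a` pairs off the cycles of `a * b`, and `b x` lies in the cycle of `a x`. An arbitrary order
  -- on the cycles decides which one of each pair gets which colour.
  let _ : LinearOrder (Quotient S) := IsWellOrder.linearOrder WellOrderingRel
  have hq : ∀ x, q x ≠ q (a x) := fun x h => hne x (Quotient.exact h)
  have hqb : ∀ x, q (b x) = q (a x) := fun x => Quotient.sound
    (⟨1, by rw [zpow_one, Equiv.Perm.mul_apply, hbb]⟩ : (a * b).SameCycle (b x) (a x))
  have hqab : ∀ x, q (a (b x)) = q x := fun x => Quotient.sound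
    (Equiv.Perm.SameCycle.symm ⟨1, by rw [zpow_one, Equiv.Perm.mul_apply]⟩ :
      (a * b).SameCycle (a (b x)) x)
  have hdec : ∀ x, decide (q (a x) < q x) = !decide (q x < q (a x)) := fun x => by
    rw [← decide_not, decide_eq_decide, not_lt]
    exact ⟨le_of_lt, fun h => lt_of_le_of_ne h (hq x).symm⟩
  refine ⟨fun x => decide (q x < q (a x)), fun x => ⟨?_, ?_⟩⟩
  · simp only [haa, hdec]
  · simp only [hqb, hqab, hdec]

/-- The edges of the matching of `Fin k × Bool` given by a permutation `σ`, transported along a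
labelling `e` of the vertices. -/
def permEdges {k : ℕ} (e : Fin k × Bool ≃ Fin (2 * k)) (σ : Equiv.Perm (Fin k)) :
    Finset (Sym2 (Fin (2 * k))) :=
  Finset.univ.image fun i => s(e (i, false), e (σ i, true))

theorem pairSet_univ_eq {V ι : Type*} [Fintype V] [DecidableEq V] [Fintype ι] {a : V → V}
    (ha : Function.Involutive a) {c : V → Bool} (hc : ∀ x, c (a x) = !c x)
    (ε : ι ≃ {x // c x = false}) :
    pairSet a Finset.univ = Finset.univ.image fun i => s((ε i).1, a (ε i).1) := by
  ext e
  simp only [pairSet, Finset.mem_image, Finset.mem_univ, true_and]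
  constructor
  · rintro ⟨x, rfl⟩
    by_cases hx : c x = false
    · exact ⟨ε.symm ⟨x, hx⟩, by simp⟩
    · refine ⟨ε.symm ⟨a x, by rw [hc]; simpa using hx⟩, ?_⟩
      simp only [Equiv.apply_symm_apply, ha x]
      exact Sym2.eq_swap
  · rintro ⟨i, rfl⟩
    exact ⟨_, rfl⟩

theorem exists_permEdges {k : ℕ} (M M' : Matchings k) :
    ∃ (e : Fin k × Bool ≃ Fin (2 * k)) (σ : Equiv.Perm (Fin k)),
      M.edges = permEdges e 1 ∧ M'.edges = permEdges e σ := by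
  obtain ⟨a, ha, ha', hM⟩ := M.exists_involution
  obtain ⟨b, hb, hb', hM'⟩ := M'.exists_involution
  obtain ⟨c, hc⟩ := exists_coloring a b ha hb ha' hb'
  have haa : Function.Involutive a := fun x => DFunLike.congr_fun ha x
  have hbb : Function.Involutive b := fun x => DFunLike.congr_fun hb x
  -- `a` exchanges the two colour classes, so each is half of the `2k` vertices.
  have hA : Fintype.card {x // c x = false} = k := by
    have h1 : Fintype.card {x // c x = false} = Fintype.card {x // ¬ c x = false} :=
      Fintype.card_congr
        { toFun := fun x => ⟨a x, by simp [(hc _).1, x.2]⟩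
          invFun := fun x => ⟨a x, by simpa [(hc _).1] using x.2⟩
          left_inv := fun x => Subtype.ext (haa x)
          right_inv := fun x => Subtype.ext (haa x) }
    have h2 := Fintype.card_subtype_compl fun x => c x = false
    have h3 := Fintype.card_subtype_le fun x => c x = false
    rw [Fintype.card_fin] at h2 h3
    omega
  let ε : Fin k ≃ {x // c x = false} := (Fintype.equivFinOfCardEq hA).symm
  let v : Fin k × Bool → Fin (2 * k) := fun p => bif p.2 then a (ε p.1) else ε p.1
  have hcv : ∀ p, c (v p) = p.2 := by
    rintro ⟨i, _ | _⟩
    · exact (ε i).2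
    · exact ((hc _).1).trans (by rw [(ε i).2]; rfl)
  have hv : Function.Bijective v := by
    rw [Fintype.bijective_iff_injective_and_card]
    refine ⟨?_, by simp [mul_comm]⟩
    rintro ⟨i, s⟩ ⟨j, s'⟩ h
    obtain rfl : s = s' := by
      have := congrArg c h
      rwa [hcv, hcv] at this
    cases s
    · have hij : i = j := ε.injective (Subtype.ext h)
      rw [hij]
    · have hij : i = j := ε.injective (Subtype.ext (a.injective h))
      rw [hij]
  -- The `true` vertices are labelled through `a`, so `M` becomes the identity. Since `b x = a ((a *
  -- b) x)`, `M'` becomes `a * b` on the `false` class.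
  let τ : Equiv.Perm {x // c x = false} := (a * b).subtypePerm fun x => by
    simp [(hc _).1, (hc _).2]
  refine ⟨Equiv.ofBijective v hv, ε.symm.permCongr τ, ?_, ?_⟩
  · rw [hM, pairSet_univ_eq haa (fun x => (hc x).1) ε]
    rfl
  · rw [hM', pairSet_univ_eq hbb (fun x => (hc x).2) ε]
    refine congrArg (fun g => Finset.univ.image g) (funext fun i => ?_)
    refine congrArg (fun y => s((ε i).1, y)) ?_
    change b (ε i) = a (ε (ε.symm (τ (ε i))))
    rw [Equiv.apply_symm_apply]
    exact (haa _).symm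

theorem permEdges_trans {k : ℕ} (e : Fin k × Bool ≃ Fin (2 * k)) (σ : Equiv.Perm (Fin k))
    (g : Equiv.Perm (Fin (2 * k))) :
    permEdges (e.trans g) σ = (permEdges e σ).image (Sym2.map g) := by
  rw [permEdges, permEdges, Finset.image_image]
  rfl

/-- Relabelling both colour classes by the same `τ` keeps the identity matching and conjugates the
other one. -/
theorem permEdges_conj {k : ℕ} (e : Fin k × Bool ≃ Fin (2 * k)) (σ τ : Equiv.Perm (Fin k)) :
    permEdges ((Equiv.prodCongr τ (Equiv.refl Bool)).trans e) σ =
      permEdges e (τ * σ * τ⁻¹) := by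
  ext d
  simp only [permEdges, Finset.mem_image, Finset.mem_univ, true_and]
  constructor
  · rintro ⟨i, rfl⟩
    exact ⟨τ i, by simp⟩
  · rintro ⟨i, rfl⟩
    exact ⟨τ⁻¹ i, by simp⟩

/-- Two pairs of matchings that are given by conjugate permutations are in the same orbit. -/
theorem exists_smul_eq_of_isConj {k : ℕ} {M M' N N' : Matchings k}
    {e e' : Fin k × Bool ≃ Fin (2 * k)} {σ σ' : Equiv.Perm (Fin k)} (h : IsConj σ σ')
    (hM : M.edges = permEdges e 1) (hM' : M'.edges = permEdges e σ)
    (hN : N.edges = permEdges e' 1) (hN' : N'.edges = permEdges e' σ') :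
    ∃ g : Equiv.Perm (Fin (2 * k)), g • M = N ∧ g • M' = N' := by
  obtain ⟨τ, hτ⟩ := isConj_iff.1 h
  let g : Equiv.Perm (Fin (2 * k)) :=
    e.symm.trans ((Equiv.prodCongr τ (Equiv.refl Bool)).trans e')
  have hg : e.trans g = (Equiv.prodCongr τ (Equiv.refl Bool)).trans e' := by
    ext x
    simp [g]
  refine ⟨g, Matchings.ext ?_, Matchings.ext ?_⟩
  · change M.edges.image (Sym2.map g) = _
    rw [hM, ← permEdges_trans, hg, permEdges_conj, hN]
    simp
  · change M'.edges.image (Sym2.map g) = _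
    rw [hM', ← permEdges_trans, hg, permEdges_conj, hN', hτ]

instance (k : ℕ) : Finite (Matchings k) :=
  Finite.of_injective Matchings.edges fun _ _ h => Matchings.ext h

/-- The conjugacy class of permutations that describes a pair of matchings. -/
noncomputable def pairClass {k : ℕ} (M M' : Matchings k) : ConjClasses (Equiv.Perm (Fin k)) :=
  ConjClasses.mk (exists_permEdges M M').choose_spec.choose

/-- `pairClass` depends on choices, and its constancy on orbits is not needed: an upper bound for
the number of orbits only requires that it separate them. -/
theorem exists_smul_eq_of_pairClass_eq {k : ℕ} {M M' N N' : Matchings k}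
    (h : pairClass M M' = pairClass N N') :
    ∃ g : Equiv.Perm (Fin (2 * k)), g • M = N ∧ g • M' = N' :=
  exists_smul_eq_of_isConj (ConjClasses.mk_eq_mk_iff_isConj.1 h)
    (exists_permEdges M M').choose_spec.choose_spec.1
    (exists_permEdges M M').choose_spec.choose_spec.2
    (exists_permEdges N N').choose_spec.choose_spec.1
    (exists_permEdges N N').choose_spec.choose_spec.2

/-- The even partition obtained by doubling the cycle type of a permutation. -/
def doublePartition {k : ℕ} (σ : Equiv.Perm (Fin k)) : EvenPartition k :=
  ⟨{ parts := σ.partition.parts.map (2 * ·)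
     parts_pos := by
      intro i hi
      obtain ⟨j, hj, rfl⟩ := Multiset.mem_map.1 hi
      have := σ.partition.parts_pos hj
      omega
     parts_sum := by
      rw [Multiset.sum_map_mul_left, Multiset.map_id', σ.partition.parts_sum, Fintype.card_fin] },
    by
      intro i (hi : i ∈ σ.partition.parts.map (2 * ·))
      obtain ⟨j, hj, rfl⟩ := Multiset.mem_map.1 hi
      exact even_two_mul j⟩

/-- The cycle type determines the conjugacy class, and doubling the parts is injective. -/
theorem card_conjClasses_le (k : ℕ) :
    Nat.card (ConjClasses (Equiv.Perm (Fin k))) ≤ Nat.card (EvenPartition k) := by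
  refine Nat.card_le_card_of_injective (fun c => doublePartition (Quotient.out c)) ?_
  intro c d h
  rw [← Quotient.out_eq c, ← Quotient.out_eq d]
  refine Quotient.sound (Equiv.Perm.partition_eq_of_isConj.2 (Nat.Partition.ext ?_))
  have h1 : (Quotient.out c).partition.parts.map (2 * ·) =
      (Quotient.out d).partition.parts.map (2 * ·) :=
    congrArg (fun p : EvenPartition k => p.1.parts) h
  exact Multiset.map_injective (fun a b hab => by simpa using hab) h1

/-- The matrix entries of an endomorphism of the matching module, one for each class of pairs. -/
noncomputable def endCoeffs (k : ℕ) :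
    (matchingModule k).IntertwiningMap (matchingModule k) →ₗ[ℂ]
      (Set.range (fun P : Matchings k × Matchings k => pairClass P.1 P.2) → ℂ) where
  toFun φ := fun c => (φ (MonoidAlgebra.single c.2.choose.1 1)).coeff c.2.choose.2
  map_add' _ _ := rfl
  map_smul' _ _ := rfl

/-- Equivariance makes matrix entries constant on orbits of pairs, and every pair is a translate of
the one chosen for its class. -/
theorem endCoeffs_injective (k : ℕ) : Function.Injective (endCoeffs k) := by
  refine (injective_iff_map_eq_zero _).2 fun φ hφ => ?_
  refine Representation.IntertwiningMap.ext
    ((MonoidAlgebra.basis (Matchings k) ℂ).ext fun M => ?_)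
  ext M'
  let c : Set.range (fun P : Matchings k × Matchings k => pairClass P.1 P.2) :=
    ⟨pairClass M M', (M, M'), rfl⟩
  obtain ⟨g, h1, h2⟩ := exists_smul_eq_of_pairClass_eq c.2.choose_spec
  have h3 : (φ (MonoidAlgebra.single c.2.choose.1 1)).coeff c.2.choose.2 = 0 := congrFun hφ c
  have h4 := Representation.IntertwiningMap.isIntertwining (matchingModule k) (matchingModule k) φ
    g (MonoidAlgebra.single c.2.choose.1 1)
  rw [Representation.ofMulAction_single] at h4
  change (φ (MonoidAlgebra.single M 1)).coeff M' = 0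
  have h5 : g • c.2.choose.1 = M := h1
  have h6 : M' = g • c.2.choose.2 := h2.symm
  rw [h5] at h4
  rw [h4, h6, Representation.coeff_ofMulAction, inv_smul_smul, h3]

instance (k : ℕ) :
    Module.Finite ℂ ((matchingModule k).IntertwiningMap (matchingModule k)) :=
  Module.Finite.of_injective (endCoeffs k) (endCoeffs_injective k)

theorem finrank_end_le (k : ℕ) :
    Module.finrank ℂ ((matchingModule k).IntertwiningMap (matchingModule k)) ≤
      Fintype.card (EvenPartition k) := by
  classical
  have := Fintype.ofFinite (Set.range (fun P : Matchings k × Matchings k => pairClass P.1 P.2))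
  refine (LinearMap.finrank_le_finrank_of_injective (endCoeffs_injective k)).trans ?_
  rw [Module.finrank_fintype_fun_eq_card, ← Nat.card_eq_fintype_card, ← Nat.card_eq_fintype_card]
  exact (Nat.card_le_card_of_injective _ Subtype.val_injective).trans (card_conjClasses_le k)

/-! ### Decompositions detected by the endomorphism algebra -/

section Decomposition

variable {G V W : Type*} [Group G] [Finite G] [AddCommGroup V] [Module ℂ V] [AddCommGroup W]
  [Module ℂ W]

/-- Maschke's averaging: a linear retraction is averaged over the group. -/
theorem exists_equivariant_retraction {ρ : Representation ℂ G V} {σ : Representation ℂ G W}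
    {φ : W →ₗ[ℂ] V} (hφ : σ.IsIntertwiningMap ρ φ) (hinj : Function.Injective φ) :
    ∃ r : V →ₗ[ℂ] W, ρ.IsIntertwiningMap σ r ∧ ∀ w, r (φ w) = w := by
  have := Fintype.ofFinite G
  obtain ⟨r₀, hr₀⟩ := φ.exists_leftInverse_of_injective (LinearMap.ker_eq_bot.2 hinj)
  have hr : ∀ w, r₀ (φ w) = w := fun w => LinearMap.congr_fun hr₀ w
  let r : V →ₗ[ℂ] W := (Fintype.card G : ℂ)⁻¹ • ∑ g : G, σ g ∘ₗ r₀ ∘ₗ ρ g⁻¹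
  have happ : ∀ v, r v = (Fintype.card G : ℂ)⁻¹ • ∑ g : G, σ g (r₀ (ρ g⁻¹ v)) := fun v => by
    simp [r]
  refine ⟨r, ⟨fun h v => ?_⟩, fun w => ?_⟩
  · rw [happ, happ, map_smul, map_sum]
    congr 1
    refine Fintype.sum_equiv (Equiv.mulLeft h⁻¹) _ _ fun g => ?_
    rw [Equiv.coe_mulLeft, ← Module.End.mul_apply, ← map_mul, ← Module.End.mul_apply (σ h),
      ← map_mul σ, mul_inv_rev, inv_inv, mul_inv_cancel_left]
  · rw [happ]
    have h1 : ∀ g : G, σ g (r₀ (ρ g⁻¹ (φ w))) = w := fun g => by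
      rw [← hφ.isIntertwining, hr, ← Module.End.mul_apply, ← map_mul, mul_inv_cancel, map_one,
        Module.End.one_apply]
    rw [Finset.sum_congr rfl fun g _ => h1 g, Finset.sum_const, Finset.card_univ,
      ← Nat.cast_smul_eq_nsmul ℂ, smul_smul, inv_mul_cancel₀, one_smul]
    exact Nat.cast_ne_zero.2 Fintype.card_ne_zero

variable {ι : Type*} [Fintype ι] [DecidableEq ι] {U : ι → Type*} [∀ i, AddCommGroup (U i)]
  [∀ i, Module ℂ (U i)] [∀ i, Nontrivial (U i)] {ρ : Representation ℂ G V}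
  {τ : ∀ i, Representation ℂ G (U i)} [Module.Finite ℂ (ρ.IntertwiningMap ρ)]

/-- Let a direct sum of nonzero representations embed equivariantly into `V`. If the number of
summands is at least the dimension of the endomorphism algebra of `V`, then the embedding is
onto, and every equivariant map from a summand to `V` is a multiple of the given one. -/
theorem surjective_and_finrank_eq_one {φ : (⨁ i, U i) →ₗ[ℂ] V}
    (hφ : (Representation.directSum τ).IsIntertwiningMap ρ φ) (hinj : Function.Injective φ)
    (hcard : Module.finrank ℂ (ρ.IntertwiningMap ρ) ≤ Fintype.card ι) :
    Function.Surjective φ ∧ ∀ i, Module.finrank ℂ ((τ i).IntertwiningMap ρ) = 1 := by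
  obtain ⟨r, hr, hrφ⟩ := exists_equivariant_retraction hφ hinj
  -- Project `V` to the `i`-th summand by `r`, then apply `ψ`. For `ψ = incl i` this is the
  -- projection of `V` onto the `i`-th embedded summand.
  let lift (i : ι) (ψ : (τ i).IntertwiningMap ρ) : ρ.IntertwiningMap ρ :=
    { toLinearMap := ψ.toLinearMap ∘ₗ DirectSum.component ℂ ι U i ∘ₗ r
      isIntertwining' := fun g => by
        ext v
        change ψ (r (ρ g v) i) = ρ g (ψ (r v i))
        rw [hr.isIntertwining, ← Representation.IntertwiningMap.isIntertwining (τ i) ρ ψ]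
        rfl }
  have lift_same (i : ι) (ψ : (τ i).IntertwiningMap ρ) (u : U i) :
      lift i ψ (φ (DirectSum.lof ℂ ι U i u)) = ψ u := by
    change ψ (r (φ (DirectSum.lof ℂ ι U i u)) i) = ψ u
    rw [hrφ, DirectSum.lof_apply]
  have lift_ne (i j : ι) (hij : i ≠ j) (ψ : (τ i).IntertwiningMap ρ) (u : U j) :
      lift i ψ (φ (DirectSum.lof ℂ ι U j u)) = 0 := by
    change ψ (r (φ (DirectSum.lof ℂ ι U j u)) i) = 0
    rw [hrφ, DirectSum.lof_eq_of, DirectSum.of_eq_of_ne _ _ _ hij, map_zero]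
  let incl (i : ι) : (τ i).IntertwiningMap ρ :=
    { toLinearMap := φ ∘ₗ DirectSum.lof ℂ ι U i
      isIntertwining' := fun g => by
        ext u
        change φ (DirectSum.lof ℂ ι U i (τ i g u)) = ρ g (φ (DirectSum.lof ℂ ι U i u))
        rw [← hφ.isIntertwining]
        congr 1
        exact (DirectSum.lmap_lof (fun i => τ i g) i u).symm }
  have sum_apply (c : ι → ℂ) (j : ι) (u : U j) :
      (∑ i, c i • lift i (incl i)) (φ (DirectSum.lof ℂ ι U j u)) = c j • incl j u := by
    rw [Representation.IntertwiningMap.sum_apply, Finset.sum_eq_single j]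
    · change c j • lift j (incl j) _ = _
      rw [lift_same]
    · intro i _ hij
      change c i • lift i (incl i) _ = _
      rw [lift_ne i j hij, smul_zero]
    · exact fun h => absurd (Finset.mem_univ j) h
  have incl_ne (i : ι) {u : U i} (hu : u ≠ 0) : incl i u ≠ 0 := fun h => by
    have h1 : DirectSum.lof ℂ ι U i u = 0 := hinj (h.trans (map_zero φ).symm)
    have h2 := congrArg (fun v : ⨁ i, U i => v i) h1
    simp only [DirectSum.lof_apply] at h2
    exact hu h2
  have hli : LinearIndependent ℂ fun i => lift i (incl i) := by
    rw [Fintype.linearIndependent_iff]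
    intro c hc j
    obtain ⟨u, hu⟩ := exists_ne (0 : U j)
    have h1 := sum_apply c j u
    rw [hc] at h1
    exact (smul_eq_zero.1 h1.symm).resolve_right (incl_ne j hu)
  have hspan : ∀ ψ : ρ.IntertwiningMap ρ, ∃ c : ι → ℂ, ∑ i, c i • lift i (incl i) = ψ := fun ψ => by
    have h1 := hli.span_eq_top_of_card_eq_finrank' (le_antisymm hli.fintype_card_le_finrank hcard)
    exact (Submodule.mem_span_range_iff_exists_fun ℂ).1 (h1 ▸ Submodule.mem_top)
  constructor
  -- The projection to the complement of the image of `φ`. It kills every summand, so all its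
  -- coordinates in the basis of projections vanish and the complement is zero.
  · let q : ρ.IntertwiningMap ρ :=
      { toLinearMap := LinearMap.id - φ ∘ₗ r
        isIntertwining' := fun g => by
          ext v
          change ρ g v - φ (r (ρ g v)) = ρ g (v - φ (r v))
          rw [hr.isIntertwining, hφ.isIntertwining, map_sub] }
    obtain ⟨c, hc⟩ := hspan q
    have hc0 : ∀ j, c j = 0 := fun j => by
      obtain ⟨u, hu⟩ := exists_ne (0 : U j)
      have h1 := sum_apply c j u
      rw [hc] at h1
      change φ _ - φ (r (φ _)) = _ at h1
      rw [hrφ, sub_self] at h1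
      exact (smul_eq_zero.1 h1.symm).resolve_right (incl_ne j hu)
    have hq : q = 0 := by
      rw [← hc]
      exact Finset.sum_eq_zero fun i _ => by rw [hc0, zero_smul]
    intro v
    refine ⟨r v, ?_⟩
    have h1 : v - φ (r v) = 0 := congrArg (fun ψ : ρ.IntertwiningMap ρ => ψ v) hq
    exact (sub_eq_zero.1 h1).symm
  · intro j
    obtain ⟨u, hu⟩ := exists_ne (0 : U j)
    refine finrank_eq_one (incl j) (fun h => incl_ne j hu (by rw [h]; rfl)) fun ψ => ?_
    -- Evaluating this expansion on the `j`-th summand leaves only the `j`-th term, so `ψ = c j •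
    -- incl j`.
    obtain ⟨c, hc⟩ := hspan (lift j ψ)
    refine ⟨c j, Representation.IntertwiningMap.ext (LinearMap.ext fun w => ?_)⟩
    have h1 := sum_apply c j w
    rw [hc, lift_same] at h1
    exact h1.symm

end Decomposition

end SpechtMatching

theorem mainTheorem3 (k : ℕ) :
    (∀ p : SpechtMatching.EvenPartition k,
      (SpechtMatching.permModule (SpechtMatching.diagram p.1) (2 * k)).IsIntertwiningMap
        (SpechtMatching.matchingModule k) (SpechtMatching.f (SpechtMatching.diagram p.1) k) ∧
      SpechtMatching.f (SpechtMatching.diagram p.1) k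
        (SpechtMatching.polytabloid
          (SpechtMatching.standardTableau (SpechtMatching.card_diagram p.1))) ≠ 0 ∧
      Function.Injective fun v : (SpechtMatching.spechtSub
          (SpechtMatching.diagram p.1) (2 * k)).toSubmodule =>
        SpechtMatching.f (SpechtMatching.diagram p.1) k v.1) ∧
    (∃ Φ : (Representation.directSum
          fun p : SpechtMatching.EvenPartition k => SpechtMatching.specht p.1).Equiv
        (SpechtMatching.matchingModule k),
      ∀ (p : SpechtMatching.EvenPartition k)
        (v : (SpechtMatching.spechtSub (SpechtMatching.diagram p.1) (2 * k)).toSubmodule),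
        Φ (DirectSum.lof ℂ (SpechtMatching.EvenPartition k)
            (fun q => (SpechtMatching.spechtSub (SpechtMatching.diagram q.1) (2 * k)).toSubmodule)
            p v) =
          SpechtMatching.f (SpechtMatching.diagram p.1) k v.1) ∧
    (∀ p : SpechtMatching.EvenPartition k,
      (SpechtMatching.specht p.1).IsIrreducible ∧
      Module.finrank ℂ ((SpechtMatching.specht p.1).IntertwiningMap
        (SpechtMatching.matchingModule k)) = 1) := by
  open SpechtMatching in
  have hne : ∀ p : EvenPartition k, ∀ t : Tableau (diagram p.1) (2 * k),
      f (diagram p.1) k (polytabloid t) ≠ 0 := fun p t =>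
    f_polytabloid_ne_zero (even_rowLen_diagram p.2) t
  have hpoly : ∀ p : EvenPartition k,
      polytabloid (standardTableau (card_diagram p.1)) ≠ 0 := fun p h =>
    hne p (standardTableau (card_diagram p.1)) (by rw [h, map_zero])
  -- Nonzero summands make the projections linearly independent; this is the instance needed for
  -- `surjective_and_finrank_eq_one`.
  have hnontriv : ∀ p : EvenPartition k,
      Nontrivial (spechtSub (diagram p.1) (2 * k)).toSubmodule := fun p =>
    ⟨⟨polytabloid (standardTableau (card_diagram p.1)), Submodule.subset_span ⟨_, rfl⟩⟩, 0,
      fun h => hpoly p (congrArg Subtype.val h)⟩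
  have hmain := surjective_and_finrank_eq_one (spechtSumMap_isIntertwiningMap k)
    (spechtSumMap_injective k) (finrank_end_le k)
  refine ⟨fun p => ⟨f_isIntertwiningMap _ k, hne p _,
    f_injective_on_specht (even_rowLen_diagram p.2)⟩, ?_, fun p => ⟨?_, hmain.2 p⟩⟩
  · refine ⟨Representation.Equiv.mk
      (LinearEquiv.ofBijective (spechtSumMap k) ⟨spechtSumMap_injective k, hmain.1⟩) fun g => ?_,
      fun p v => spechtSumMap_lof k p v⟩
    exact LinearMap.ext fun v => (spechtSumMap_isIntertwiningMap k).isIntertwining g v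
  · exact spechtSub_isIrreducible _ _ _ (hpoly p)
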